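/- Let $x_1,\dots,x_n$ ($n\ge 1$) be points of a metric space $(\mathcal X,D)$, let $\ell\ge 1$ be real, let $k\ge 2$ be an integer, and let $\beta\ge 1$ be such that $\beta k$ is an integer. For centers $c_1,\dots,c_t\in\mathcal X$ put $\phi(x_i)=\min_{j}D(x_i,c_j)^\ell$ and $\phi=\sum_{i=1}^n\phi(x_i)$, and let $\phi^*$ be the infimum of $\phi$ over all choices of $k$ centers in $\mathcal X$. $D^\ell$ sampling chooses the first center uniformly at random from $x_1,\dots,x_n$, and each further center equal to $x_i$ with probability $\phi(x_i)/\phi$, where $\phi$ is the current potential (if $\phi=0$, the choice is arbitrary). Let $r_u=2$ if $\ell=2$ and $D$ is Euclidean, $r_u=2^\ell$ otherwise, and $r_D=2^\ell r_u$. Let $\varphi=(1+\sqrt5)/2$ and $H_m=1+\frac12+\dots+\frac1m$. Let $\phi$ be the potential resulting from choosing $\beta k$ centers by $D^\ell$ sampling. Then there is a constant $c>0$, depending only on $\ell$, $k$ and $\beta$ (and not on $\mathcal X$, $n$ or the points), such that $$\mathbb E[\phi]\le\left(r_D\left(1+\min\left\{\frac{\varphi(k-2)}{(\beta-1)k+\varphi},\,H_{k-1}\right\}\right)-\frac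 cn\right)\phi^*.$$ Moreover, with $$C=r_D\left(1+\frac{\varphi(k-2)}{(\beta-1)k+\varphi}\right)-r_u\left(1+\frac{\varphi(k-1)}{(\beta-1)k+\varphi}\right)$$ one has $C\ge 0$ and $$\mathbb E[\phi]\le\left(r_D\left(1+\frac{\varphi(k-2)}{(\beta-1)k+\varphi}\right)-\frac{2C}n\right)\phi^*.$$ -/

import Mathlib

/-- The contribution `min_j D(y, c_j)^ℓ` of a single point `y` to the potential, for a family of
cluster centers `c`. It is only used for finite nonempty families, for which the infimum is a
minimum. -/
noncomputable def pointCost {X : Type*} [MetricSpace X] (ℓ : ℝ) {J : Type*} (c : J → X) (y : X) :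
    ℝ :=
  ⨅ j, dist y (c j) ^ ℓ

/-- The potential `φ = ∑ i, min_j D(x_i, c_j)^ℓ` of the data points `x` for the centers `c`. -/
noncomputable def potential {X : Type*} [MetricSpace X] (ℓ : ℝ) {n : ℕ} (x : Fin n → X)
    {J : Type*} (c : J → X) : ℝ :=
  ∑ i, pointCost ℓ c (x i)

/-- The optimal potential `φ*` over all choices of `k` centers in the space `X`
(an infimum, so that nothing has to be assumed about the existence of a minimizer). -/
noncomputable def optimalPotential {X : Type*} [MetricSpace X] (ℓ : ℝ) {n : ℕ} (x : Fin n → X)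
    (k : ℕ) : ℝ :=
  ⨅ c : Fin k → X, potential ℓ x c

/-- The centers `x_j`, `j ∈ S`, given by a set `S` of indices of data points. -/
def centers {X : Type*} {n : ℕ} (x : Fin n → X) (S : Finset (Fin n)) : S → X :=
  fun j => x j

theorem potential_nonneg {X : Type*} [MetricSpace X] (ℓ : ℝ) {n : ℕ} (x : Fin n → X)
    {J : Type*} (c : J → X) : 0 ≤ potential ℓ x c :=
  Finset.sum_nonneg fun _ _ => Real.iInf_nonneg fun _ => Real.rpow_nonneg dist_nonneg _

theorem sum_pointCost_div {X : Type*} [MetricSpace X] (ℓ : ℝ) {n : ℕ} (x : Fin n → X)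
    {J : Type*} (c : J → X) (h : potential ℓ x c ≠ 0) :
    ∑ i, ENNReal.ofReal (pointCost ℓ c (x i) / potential ℓ x c) = 1 := by
  rw [← ENNReal.ofReal_sum_of_nonneg, ← Finset.sum_div]
  · change ENNReal.ofReal (potential ℓ x c / potential ℓ x c) = 1
    rw [div_self h, ENNReal.ofReal_one]
  · intro i _
    exact div_nonneg (Real.iInf_nonneg fun _ => Real.rpow_nonneg dist_nonneg _)
      (potential_nonneg ℓ x c)

open Classical in
/-- The law of the index of the next center when the points with index in `S` have been chosen:
uniform for the first center, and afterwards `x_i` is chosen with probability `φ(x_i) / φ`.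
If `φ = 0` these probabilities are undefined and the choice is irrelevant (the potential stays
`0`); it is then made uniformly. -/
noncomputable def nextCenter {X : Type*} [MetricSpace X] (ℓ : ℝ) {n : ℕ} [NeZero n]
    (x : Fin n → X) (S : Finset (Fin n)) : PMF (Fin n) :=
  if h : S = ∅ ∨ potential ℓ x (centers x S) = 0 then PMF.uniformOfFintype (Fin n)
  else PMF.ofFintype
    (fun i => ENNReal.ofReal
      (pointCost ℓ (centers x S) (x i) / potential ℓ x (centers x S)))
    (sum_pointCost_div ℓ x (centers x S) fun h0 => h (Or.inr h0))

/-- `D^ℓ` sampling: the law of the set of (indices of) centers after `t` successive choices,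
starting from the set `S` of centers that are already there. -/
noncomputable def dSampling {X : Type*} [MetricSpace X] (ℓ : ℝ) {n : ℕ} [NeZero n]
    (x : Fin n → X) : ℕ → Finset (Fin n) → PMF (Finset (Fin n))
  | 0, S => PMF.pure S
  | t + 1, S => (nextCenter ℓ x S).bind fun i => dSampling ℓ x t (insert i S)

/-- The expected potential `E[φ]` after choosing `t` centers by `D^ℓ` sampling. -/
noncomputable def expectedPotential {X : Type*} [MetricSpace X] (ℓ : ℝ) {n : ℕ} [NeZero n]
    (x : Fin n → X) (t : ℕ) : ℝ :=
  ∑ S : Finset (Fin n), (dSampling ℓ x t ∅ S).toReal * potential ℓ x (centers x S)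

/-- The metric of `X` is Euclidean: `X` is (isometric to) a subset of some `ℝ^d` with the
Euclidean distance. -/
def IsEuclideanMetric (X : Type*) [MetricSpace X] : Prop :=
  ∃ (d : ℕ) (f : X → EuclideanSpace ℝ (Fin d)), Isometry f

open Classical in
/-- The constant `r_u`: it is `2` if `ℓ = 2` and the metric is Euclidean, and `2 ^ ℓ` otherwise. -/
noncomputable def rU (ℓ : ℝ) (X : Type*) [MetricSpace X] : ℝ :=
  if ℓ = 2 ∧ IsEuclideanMetric X then 2 else 2 ^ ℓ

/-- The constant `r_D = 2 ^ ℓ * r_u`. -/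
noncomputable def rD (ℓ : ℝ) (X : Type*) [MetricSpace X] : ℝ :=
  2 ^ ℓ * rU ℓ X

/-- The term `φ_g (k - 2) / ((β - 1) k + φ_g)`, with the golden ratio `φ_g`. -/
noncomputable def goldenTerm (k : ℕ) (β : ℝ) : ℝ :=
  Real.goldenRatio * ((k : ℝ) - 2) / ((β - 1) * k + Real.goldenRatio)

/-- The constant `C` of the correction `2 C / n`. -/
noncomputable def correctionC (ℓ : ℝ) (X : Type*) [MetricSpace X] (k : ℕ) (β : ℝ) : ℝ :=
  rD ℓ X * (1 + goldenTerm k β)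
    - rU ℓ X * (1 + Real.goldenRatio * ((k : ℝ) - 1) / ((β - 1) * k + Real.goldenRatio))

/-! ### Point costs and the triangle inequality for `ℓ`-th powers. -/

section Basic

variable {X : Type*} [MetricSpace X] {ℓ : ℝ} {n : ℕ} {x : Fin n → X}

/-! Fix any partition of the points into `k` clusters and call a cluster covered once it contains a
center. Let P and Q be the covered and uncovered potentials, and O the sum of `rD * clusterCost`
over uncovered clusters. The expected potential after further sampling is bounded by aP + bO + fQ,
with coefficients depending only on the number of steps left and the number u of uncovered clusters.

The engine is `SamplingBound.step`: the next center hits a covered cluster with probability P/(P+Q),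
and otherwise covers a new cluster whose expected cost is controlled by `sum_pointCost_mul_le`.
Solving this recursion gives harmonic coefficients when there are u steps (`samplingBound_harmonic`)
and golden-ratio coefficients when there are s extra steps (`samplingBound_golden`).

After the uniform first center, u = k - 1. Averaging over it (`expectedPotential_le_of_clustering`)
replaces `rD` by the smaller `rU` on its own cluster; the saving is the correction of order 1/n.
Finally, every choice of `k` centers induces a clustering, so the bound passes to the infimum. -/

theorem pointCost_nonneg {J : Type*} (c : J → X) (y : X) : 0 ≤ pointCost ℓ c y :=
  Real.iInf_nonneg fun _ => Real.rpow_nonneg dist_nonneg _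

theorem pointCost_le {J : Type*} (c : J → X) (y : X) (j : J) :
    pointCost ℓ c y ≤ dist y (c j) ^ ℓ :=
  ciInf_le ⟨0, by rintro _ ⟨j, rfl⟩; exact Real.rpow_nonneg dist_nonneg _⟩ j

theorem pointCost_centers_le {S : Finset (Fin n)} {j : Fin n} (hj : j ∈ S) (y : X) :
    pointCost ℓ (centers x S) y ≤ dist y (x j) ^ ℓ :=
  pointCost_le (centers x S) y ⟨j, hj⟩

theorem exists_pointCost_eq {J : Type*} [Finite J] [Nonempty J] (c : J → X) (y : X) :
    ∃ j, dist y (c j) ^ ℓ = pointCost ℓ c y :=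
  exists_eq_ciInf_of_finite

theorem exists_pointCost_centers_eq {S : Finset (Fin n)} (hS : S.Nonempty) (y : X) :
    ∃ j ∈ S, dist y (x j) ^ ℓ = pointCost ℓ (centers x S) y := by
  have : Nonempty S := hS.to_subtype
  obtain ⟨j, hj⟩ := exists_pointCost_eq (ℓ := ℓ) (centers x S) y
  exact ⟨j, j.2, hj⟩

theorem pointCost_centers_anti {S T : Finset (Fin n)} (hS : S.Nonempty) (h : S ⊆ T) (y : X) :
    pointCost ℓ (centers x T) y ≤ pointCost ℓ (centers x S) y := by
  obtain ⟨j, hj, e⟩ := exists_pointCost_centers_eq (ℓ := ℓ) (x := x) hS y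
  rw [← e]
  exact pointCost_centers_le (h hj) y

theorem potential_centers_anti {S T : Finset (Fin n)} (hS : S.Nonempty) (h : S ⊆ T) :
    potential ℓ x (centers x T) ≤ potential ℓ x (centers x S) :=
  Finset.sum_le_sum fun _ _ => pointCost_centers_anti hS h _

theorem dist_rpow_le (hℓ : 1 ≤ ℓ) (a b c : X) :
    dist a c ^ ℓ ≤ 2 ^ (ℓ - 1) * (dist a b ^ ℓ + dist b c ^ ℓ) :=
  (Real.rpow_le_rpow dist_nonneg (dist_triangle a b c) (by linarith)).trans
    (by exact_mod_cast NNReal.rpow_add_le_mul_rpow_add_rpow (nndist a b) (nndist b c) hℓ)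

theorem two_mul_two_rpow (ℓ : ℝ) : 2 * (2 : ℝ) ^ (ℓ - 1) = 2 ^ ℓ := by
  rw [Real.rpow_sub_one two_ne_zero]; ring

theorem two_le_two_rpow (hℓ : 1 ≤ ℓ) : (2 : ℝ) ≤ 2 ^ ℓ := by
  simpa using Real.rpow_le_rpow_of_exponent_le (one_le_two (α := ℝ)) hℓ

end Basic

/-! ### One-step recursion and monotonicity of the expected potential. -/

section Expectation

variable {X : Type*} [MetricSpace X]

/-- The expected potential after `t` further steps of `D^ℓ` sampling from the centers in `S`. -/
noncomputable def expectedPotentialFrom (ℓ : ℝ) {n : ℕ} [NeZero n] (x : Fin n → X) (t : ℕ)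
    (S : Finset (Fin n)) : ℝ :=
  ∑ T : Finset (Fin n), (dSampling ℓ x t S T).toReal * potential ℓ x (centers x T)

variable {ℓ : ℝ} {n : ℕ} [NeZero n] {x : Fin n → X}

theorem expectedPotentialFrom_zero (S : Finset (Fin n)) :
    expectedPotentialFrom ℓ x 0 S = potential ℓ x (centers x S) := by
  classical
  unfold expectedPotentialFrom
  rw [Finset.sum_eq_single S]
  · simp [dSampling]
  · intro T _ hT
    simp [dSampling, PMF.pure_apply, hT]
  · simp

theorem expectedPotentialFrom_succ (t : ℕ) (S : Finset (Fin n)) :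
    expectedPotentialFrom ℓ x (t + 1) S =
      ∑ i, (nextCenter ℓ x S i).toReal * expectedPotentialFrom ℓ x t (insert i S) := by
  classical
  unfold expectedPotentialFrom
  simp_rw [Finset.mul_sum]
  rw [Finset.sum_comm]
  refine Finset.sum_congr rfl fun T _ => ?_
  simp only [dSampling]
  rw [PMF.bind_apply, tsum_fintype, ENNReal.toReal_sum, Finset.sum_mul]
  · refine Finset.sum_congr rfl fun i _ => ?_
    rw [ENNReal.toReal_mul]
    ring
  · intro i _
    exact ENNReal.mul_ne_top (PMF.apply_ne_top _ _) (PMF.apply_ne_top _ _)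

theorem sum_toReal_nextCenter (S : Finset (Fin n)) :
    ∑ i, (nextCenter ℓ x S i).toReal = 1 := by
  rw [← ENNReal.toReal_sum fun i _ => PMF.apply_ne_top _ _, ← tsum_fintype (L := .unconditional _),
    PMF.tsum_coe, ENNReal.toReal_one]

theorem expectedPotentialFrom_le (t : ℕ) {S : Finset (Fin n)} (hS : S.Nonempty) :
    expectedPotentialFrom ℓ x t S ≤ potential ℓ x (centers x S) := by
  induction t generalizing S with
  | zero => exact (expectedPotentialFrom_zero S).le
  | succ t ih =>
    rw [expectedPotentialFrom_succ]
    calc _ ≤ ∑ i, (nextCenter ℓ x S i).toReal * potential ℓ x (centers x S) := by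
          refine Finset.sum_le_sum fun i _ => mul_le_mul_of_nonneg_left ?_ ENNReal.toReal_nonneg
          exact (ih (Finset.insert_nonempty _ _)).trans
            (potential_centers_anti hS (Finset.subset_insert _ _))
      _ = _ := by rw [← Finset.sum_mul, sum_toReal_nextCenter, one_mul]

theorem expectedPotentialFrom_succ_le (t : ℕ) {S : Finset (Fin n)} (hS : S.Nonempty) :
    expectedPotentialFrom ℓ x (t + 1) S ≤ expectedPotentialFrom ℓ x t S := by
  induction t generalizing S with
  | zero => exact (expectedPotentialFrom_le 1 hS).trans (expectedPotentialFrom_zero S).ge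
  | succ t ih =>
    rw [expectedPotentialFrom_succ, expectedPotentialFrom_succ t]
    exact Finset.sum_le_sum fun i _ =>
      mul_le_mul_of_nonneg_left (ih (Finset.insert_nonempty _ _)) ENNReal.toReal_nonneg

theorem expectedPotentialFrom_anti {S : Finset (Fin n)} (hS : S.Nonempty) :
    Antitone fun t => expectedPotentialFrom ℓ x t S :=
  antitone_nat_of_succ_le fun t => expectedPotentialFrom_succ_le t hS

theorem toReal_nextCenter_empty (i : Fin n) :
    (nextCenter ℓ x ∅ i).toReal = 1 / n := by
  simp [nextCenter]

theorem toReal_nextCenter {S : Finset (Fin n)} (hS : S.Nonempty)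
    (h0 : potential ℓ x (centers x S) ≠ 0) (i : Fin n) :
    (nextCenter ℓ x S i).toReal =
      pointCost ℓ (centers x S) (x i) / potential ℓ x (centers x S) := by
  have h : ¬ (S = ∅ ∨ potential ℓ x (centers x S) = 0) := by simp [hS.ne_empty, h0]
  rw [nextCenter, dif_neg h, PMF.ofFintype_apply,
    ENNReal.toReal_ofReal (div_nonneg (pointCost_nonneg _ _) (potential_nonneg _ _ _))]

theorem potential_mul_expectedPotentialFrom_succ (t : ℕ) {S : Finset (Fin n)} (hS : S.Nonempty)
    (h0 : potential ℓ x (centers x S) ≠ 0) :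
    potential ℓ x (centers x S) * expectedPotentialFrom ℓ x (t + 1) S =
      ∑ i, pointCost ℓ (centers x S) (x i) * expectedPotentialFrom ℓ x t (insert i S) := by
  rw [expectedPotentialFrom_succ, Finset.mul_sum]
  refine Finset.sum_congr rfl fun i _ => ?_
  rw [toReal_nextCenter hS h0]
  field_simp

theorem expectedPotential_succ (t : ℕ) :
    expectedPotential ℓ x (t + 1) = (∑ i, expectedPotentialFrom ℓ x t {i}) / n := by
  change expectedPotentialFrom ℓ x (t + 1) ∅ = _
  rw [expectedPotentialFrom_succ, Finset.sum_div]
  refine Finset.sum_congr rfl fun i _ => ?_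
  rw [toReal_nextCenter_empty, insert_empty_eq]
  ring

end Expectation

/-! ### Cost of one cluster under a uniform or a `D^ℓ`-sampled center. -/

section Clusters

variable {X : Type*} [MetricSpace X]

/-- The optimal cost of the cluster `A` of data points with a single center. -/
noncomputable def clusterCost (ℓ : ℝ) {n : ℕ} (x : Fin n → X) (A : Finset (Fin n)) : ℝ :=
  ⨅ c : X, ∑ i ∈ A, dist (x i) c ^ ℓ

variable {ℓ : ℝ} {n : ℕ} {x : Fin n → X}

theorem clusterCost_nonneg (A : Finset (Fin n)) : 0 ≤ clusterCost ℓ x A :=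
  Real.iInf_nonneg fun _ => Finset.sum_nonneg fun _ _ => Real.rpow_nonneg dist_nonneg _

theorem clusterCost_le (A : Finset (Fin n)) (c : X) :
    clusterCost ℓ x A ≤ ∑ i ∈ A, dist (x i) c ^ ℓ :=
  ciInf_le ⟨0, by
    rintro _ ⟨c, rfl⟩
    exact Finset.sum_nonneg fun _ _ => Real.rpow_nonneg dist_nonneg _⟩ c

/-- Hence a cluster of positive cost has at least two points, which is the source of the factor 2 in
the correction 2C/n. -/
theorem clusterCost_eq_zero (hℓ : 1 ≤ ℓ) {A : Finset (Fin n)} (hA : A.card ≤ 1) :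
    clusterCost ℓ x A = 0 := by
  refine le_antisymm ?_ (clusterCost_nonneg A)
  rcases Nat.le_one_iff_eq_zero_or_eq_one.1 hA with h | h
  · rw [Finset.card_eq_zero.1 h]
    simp [clusterCost, Real.iInf_const_zero]
  · obtain ⟨a, rfl⟩ := Finset.card_eq_one.1 h
    refine (clusterCost_le {a} (x a)).trans ?_
    rw [Finset.sum_singleton, dist_self, Real.zero_rpow (by linarith)]

theorem le_mul_clusterCost {A : Finset (Fin n)} {r s : ℝ} (hr : 0 ≤ r) (hA : A.Nonempty)
    (h : ∀ c : X, s ≤ r * ∑ i ∈ A, dist (x i) c ^ ℓ) : s ≤ r * clusterCost ℓ x A := by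
  obtain ⟨a, _⟩ := hA
  have : Nonempty X := ⟨x a⟩
  rw [clusterCost, Real.mul_iInf_of_nonneg hr]
  exact le_ciInf h

/-- Pass from `a` to `b` through `c`. The diagonal terms vanish, so each distance to `c` is used
2(|A| - 1) times, not 2|A|; the infimum over `c` is taken last. -/
theorem sum_dist_rpow_le (hℓ : 1 ≤ ℓ) (A : Finset (Fin n)) :
    ∑ a ∈ A, ∑ b ∈ A, dist (x a) (x b) ^ ℓ ≤ 2 ^ ℓ * ((A.card : ℝ) - 1) * clusterCost ℓ x A := by
  classical
  rcases A.eq_empty_or_nonempty with rfl | hA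
  · rw [clusterCost_eq_zero hℓ (by simp)]
    simp
  have hc : (1 : ℝ) ≤ A.card := by exact_mod_cast hA.card_pos
  refine le_mul_clusterCost (mul_nonneg (by positivity) (by linarith)) hA fun c => ?_
  set d : Fin n → ℝ := fun i => dist (x i) c ^ ℓ with hd
  have key : ∀ a ∈ A, ∑ b ∈ A, dist (x a) (x b) ^ ℓ ≤
      2 ^ (ℓ - 1) * (((A.card : ℝ) - 1) * d a + (∑ b ∈ A, d b - d a)) := by
    intro a ha
    rw [← Finset.add_sum_erase A _ ha, dist_self, Real.zero_rpow (by linarith), zero_add,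
      ← Finset.add_sum_erase A d ha, add_sub_cancel_left]
    calc _ ≤ ∑ b ∈ A.erase a, 2 ^ (ℓ - 1) * (d a + d b) :=
          Finset.sum_le_sum fun b _ => by
            have := dist_rpow_le hℓ (x a) c (x b)
            rwa [dist_comm c] at this
      _ = _ := by
          rw [← Finset.mul_sum, Finset.sum_add_distrib, Finset.sum_const,
            Finset.card_erase_of_mem ha, nsmul_eq_mul, Nat.cast_pred hA.card_pos]
  refine (Finset.sum_le_sum key).trans (le_of_eq ?_)
  rw [← Finset.mul_sum, Finset.sum_add_distrib, Finset.sum_sub_distrib, ← Finset.mul_sum,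
    Finset.sum_const, nsmul_eq_mul, ← two_mul_two_rpow ℓ]
  ring

/-- Expanding the squares, the two sides differ by exactly twice the squared norm of the sum of the
vectors. -/
theorem sum_norm_sub_sq_le {E ι : Type*} [NormedAddCommGroup E] [InnerProductSpace ℝ E]
    (A : Finset ι) (v : ι → E) :
    ∑ a ∈ A, ∑ b ∈ A, ‖v a - v b‖ ^ 2 ≤ 2 * A.card * ∑ a ∈ A, ‖v a‖ ^ 2 := by
  have h : ∑ a ∈ A, ∑ b ∈ A, ‖v a - v b‖ ^ 2 =
      2 * A.card * ∑ a ∈ A, ‖v a‖ ^ 2 - 2 * inner ℝ (∑ a ∈ A, v a) (∑ b ∈ A, v b) := by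
    simp_rw [norm_sub_sq_real, Finset.sum_add_distrib, Finset.sum_sub_distrib, ← Finset.mul_sum,
      Finset.sum_const, sum_inner, inner_sum, nsmul_eq_mul]
    rw [← Finset.mul_sum]
    ring
  rw [h]
  have := real_inner_self_nonneg (x := ∑ a ∈ A, v a)
  linarith

theorem sum_dist_sq_le (hX : IsEuclideanMetric X) (A : Finset (Fin n)) :
    ∑ a ∈ A, ∑ b ∈ A, dist (x a) (x b) ^ (2 : ℝ) ≤ 2 * (A.card : ℝ) * clusterCost 2 x A := by
  obtain ⟨d, f, hf⟩ := hX
  rcases A.eq_empty_or_nonempty with rfl | hA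
  · simp
  refine le_mul_clusterCost (by positivity) hA fun c => ?_
  have := sum_norm_sub_sq_le A fun i => f (x i) - f c
  simp_rw [sub_sub_sub_cancel_right, ← dist_eq_norm, hf.dist_eq] at this
  simpa using this

theorem rU_eq_or (ℓ : ℝ) (X : Type*) [MetricSpace X] :
    rU ℓ X = 2 ^ ℓ ∨ (ℓ = 2 ∧ IsEuclideanMetric X ∧ rU ℓ X = 2) := by
  unfold rU
  split_ifs with h
  · exact Or.inr ⟨h.1, h.2, rfl⟩
  · exact Or.inl rfl

theorem two_le_rU (hℓ : 1 ≤ ℓ) (X : Type*) [MetricSpace X] : 2 ≤ rU ℓ X := by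
  rcases rU_eq_or ℓ X with h | ⟨_, _, h⟩
  · exact h ▸ two_le_two_rpow hℓ
  · exact h.ge

/-- A center chosen uniformly from `A` has expected cost at most `rU * clusterCost`; outside the
Euclidean case there is a gain from the zero distance of the center to itself. -/
theorem exists_sum_dist_rpow_le_rU (hℓ : 1 ≤ ℓ) :
    ∃ s : ℝ, 0 ≤ s ∧ (s = 1 ∨ (ℓ = 2 ∧ rU ℓ X = 2)) ∧
      ∀ (n : ℕ) (x : Fin n → X) (A : Finset (Fin n)),
        ∑ a ∈ A, ∑ b ∈ A, dist (x a) (x b) ^ ℓ ≤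
          rU ℓ X * ((A.card : ℝ) - s) * clusterCost ℓ x A := by
  rcases rU_eq_or ℓ X with h | ⟨rfl, hX, h⟩
  · exact ⟨1, zero_le_one, Or.inl rfl, fun n x A => h ▸ sum_dist_rpow_le hℓ A⟩
  · exact ⟨0, le_rfl, Or.inr ⟨rfl, h⟩, fun n x A => by simpa [h] using sum_dist_sq_le hX A⟩

theorem sum_dist_rpow_le_rU (hℓ : 1 ≤ ℓ) (A : Finset (Fin n)) :
    ∑ a ∈ A, ∑ b ∈ A, dist (x a) (x b) ^ ℓ ≤ rU ℓ X * A.card * clusterCost ℓ x A := by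
  obtain ⟨s, hs, _, h⟩ := exists_sum_dist_rpow_le_rU (X := X) hℓ
  refine (h n x A).trans (mul_le_mul_of_nonneg_right ?_ (clusterCost_nonneg A))
  have := two_le_rU hℓ X
  exact mul_le_mul_of_nonneg_left (by linarith) (by linarith)

/-- A center chosen from `A` by `D^ℓ` sampling has expected cost at most `rD * clusterCost`. -/
theorem sum_pointCost_mul_le (hℓ : 1 ≤ ℓ) {S : Finset (Fin n)} (hS : S.Nonempty)
    (A : Finset (Fin n)) :
    ∑ a ∈ A, pointCost ℓ (centers x S) (x a) *
        ∑ b ∈ A, pointCost ℓ (centers x (insert a S)) (x b) ≤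
      (∑ a ∈ A, pointCost ℓ (centers x S) (x a)) * (rD ℓ X * clusterCost ℓ x A) := by
  rcases A.eq_empty_or_nonempty with rfl | hA
  · simp
  have hc : (0 : ℝ) < A.card := by exact_mod_cast hA.card_pos
  set κ : Fin n → ℝ := fun a => pointCost ℓ (centers x S) (x a) with hκ
  set M : Fin n → ℝ := fun a => ∑ b ∈ A, pointCost ℓ (centers x (insert a S)) (x b) with hM
  set D : Fin n → ℝ := fun a => ∑ b ∈ A, dist (x a) (x b) ^ ℓ with hD
  set K : ℝ := ∑ a ∈ A, κ a with hK
  have hK0 : 0 ≤ K := Finset.sum_nonneg fun _ _ => pointCost_nonneg _ _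
  have hM0 : ∀ a, 0 ≤ M a := fun a => Finset.sum_nonneg fun _ _ => pointCost_nonneg _ _
  have hD0 : ∀ a, 0 ≤ D a := fun a =>
    Finset.sum_nonneg fun _ _ => Real.rpow_nonneg dist_nonneg _
  have hMK : ∀ a, M a ≤ K := fun a =>
    Finset.sum_le_sum fun b _ => pointCost_centers_anti hS (Finset.subset_insert _ _) _
  have hMD : ∀ a, M a ≤ D a := fun a => Finset.sum_le_sum fun b _ => by
    rw [dist_comm]
    exact pointCost_centers_le (Finset.mem_insert_self _ _) _
  -- Going from `x a` through `x b` to the center nearest to `x b`, then summing over `b` in `A`.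
  have hκa : ∀ a, A.card * κ a ≤ 2 ^ (ℓ - 1) * (K + D a) := fun a => by
    have : ∑ b ∈ A, κ a ≤ ∑ b ∈ A, 2 ^ (ℓ - 1) * (κ b + dist (x a) (x b) ^ ℓ) := by
      refine Finset.sum_le_sum fun b _ => ?_
      obtain ⟨j, hj, e⟩ := exists_pointCost_centers_eq (ℓ := ℓ) (x := x) hS (x b)
      simp only [hκ]
      rw [← e, add_comm]
      exact (pointCost_centers_le hj _).trans (dist_rpow_le hℓ _ _ _)
    rwa [Finset.sum_const, nsmul_eq_mul, ← Finset.mul_sum, Finset.sum_add_distrib] at this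
  refine le_of_mul_le_mul_left ?_ hc
  calc A.card * ∑ a ∈ A, κ a * M a = ∑ a ∈ A, A.card * κ a * M a := by
        rw [Finset.mul_sum]; simp_rw [mul_assoc]
    _ ≤ ∑ a ∈ A, 2 ^ ℓ * K * D a := by
        refine Finset.sum_le_sum fun a _ => ?_
        calc _ ≤ 2 ^ (ℓ - 1) * (K + D a) * M a := mul_le_mul_of_nonneg_right (hκa a) (hM0 a)
          _ = 2 ^ (ℓ - 1) * (K * M a + D a * M a) := by ring
          -- Each of the two terms uses a different bound on the new cost `M a`: by `D a` in the
          -- first, by `K` in the second.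
          _ ≤ 2 ^ (ℓ - 1) * (K * D a + D a * K) := by
              have h1 := mul_le_mul_of_nonneg_left (hMD a) hK0
              have h2 := mul_le_mul_of_nonneg_left (hMK a) (hD0 a)
              exact mul_le_mul_of_nonneg_left (add_le_add h1 h2) (by positivity)
          _ = _ := by rw [← two_mul_two_rpow ℓ]; ring
    _ = 2 ^ ℓ * K * ∑ a ∈ A, D a := (Finset.mul_sum _ _ _).symm
    _ ≤ 2 ^ ℓ * K * (rU ℓ X * A.card * clusterCost ℓ x A) :=
        mul_le_mul_of_nonneg_left (sum_dist_rpow_le_rU hℓ A) (by positivity)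
    _ = _ := by unfold rD; ring

end Clusters

/-! ### Covered and uncovered clusters, and the effect of one more center. -/

section OneStep

variable {X : Type*} [MetricSpace X] {n k : ℕ}

/-- The cluster with label `j` of the clustering `σ`. -/
def cluster (σ : Fin n → Fin k) (j : Fin k) : Finset (Fin n) :=
  Finset.univ.filter fun i => σ i = j

/-- The contribution of the cluster with label `j` to the potential. -/
noncomputable def clusterPotential (ℓ : ℝ) (x : Fin n → X) (σ : Fin n → Fin k)
    (S : Finset (Fin n)) (j : Fin k) : ℝ :=
  ∑ i ∈ cluster σ j, pointCost ℓ (centers x S) (x i)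

/-- The potential of the clusters that contain a center. -/
noncomputable def coveredPotential (ℓ : ℝ) (x : Fin n → X) (σ : Fin n → Fin k)
    (S : Finset (Fin n)) : ℝ :=
  ∑ j ∈ S.image σ, clusterPotential ℓ x σ S j

/-- The potential of the clusters that contain no center. -/
noncomputable def uncoveredPotential (ℓ : ℝ) (x : Fin n → X) (σ : Fin n → Fin k)
    (S : Finset (Fin n)) : ℝ :=
  ∑ j ∈ (S.image σ)ᶜ, clusterPotential ℓ x σ S j

/-- The cost bound `rD * clusterCost`, summed over the clusters that contain no center. -/
noncomputable def uncoveredCost (ℓ : ℝ) (x : Fin n → X) (σ : Fin n → Fin k)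
    (S : Finset (Fin n)) : ℝ :=
  ∑ j ∈ (S.image σ)ᶜ, rD ℓ X * clusterCost ℓ x (cluster σ j)

/-- `t` steps of `D^ℓ` sampling from any state with `u` uncovered clusters give an expected
potential bounded by a combination, with coefficients `a`, `b`, `f`, of the covered potential,
the uncovered cost and the uncovered potential. -/
def SamplingBound (ℓ : ℝ) [NeZero n] (x : Fin n → X) (σ : Fin n → Fin k) (t u : ℕ)
    (a b f : ℝ) : Prop :=
  ∀ S : Finset (Fin n), S.Nonempty → ((S.image σ)ᶜ).card = u →
    expectedPotentialFrom ℓ x t S ≤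
      a * coveredPotential ℓ x σ S + b * uncoveredCost ℓ x σ S + f * uncoveredPotential ℓ x σ S

variable {ℓ : ℝ} {x : Fin n → X} {σ : Fin n → Fin k}

theorem clusterPotential_nonneg (S : Finset (Fin n)) (j : Fin k) :
    0 ≤ clusterPotential ℓ x σ S j :=
  Finset.sum_nonneg fun _ _ => pointCost_nonneg _ _

theorem clusterPotential_anti {S T : Finset (Fin n)} (hS : S.Nonempty) (h : S ⊆ T) (j : Fin k) :
    clusterPotential ℓ x σ T j ≤ clusterPotential ℓ x σ S j :=
  Finset.sum_le_sum fun _ _ => pointCost_centers_anti hS h _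

theorem coveredPotential_nonneg (S : Finset (Fin n)) : 0 ≤ coveredPotential ℓ x σ S :=
  Finset.sum_nonneg fun _ _ => clusterPotential_nonneg _ _

theorem uncoveredPotential_nonneg (S : Finset (Fin n)) : 0 ≤ uncoveredPotential ℓ x σ S :=
  Finset.sum_nonneg fun _ _ => clusterPotential_nonneg _ _

theorem rU_nonneg (ℓ : ℝ) (X : Type*) [MetricSpace X] : 0 ≤ rU ℓ X := by
  unfold rU; split_ifs <;> positivity

theorem rD_nonneg (ℓ : ℝ) (X : Type*) [MetricSpace X] : 0 ≤ rD ℓ X :=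
  mul_nonneg (by positivity) (rU_nonneg ℓ X)

theorem uncoveredCost_nonneg (S : Finset (Fin n)) : 0 ≤ uncoveredCost ℓ x σ S :=
  Finset.sum_nonneg fun _ _ => mul_nonneg (rD_nonneg _ _) (clusterCost_nonneg _)

theorem sum_eq_sum_cluster (σ : Fin n → Fin k) (g : Fin n → ℝ) :
    ∑ i, g i = ∑ j, ∑ i ∈ cluster σ j, g i :=
  (Finset.sum_fiberwise Finset.univ σ g).symm

theorem covered_add_uncovered (S : Finset (Fin n)) :
    coveredPotential ℓ x σ S + uncoveredPotential ℓ x σ S = potential ℓ x (centers x S) := by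
  unfold coveredPotential uncoveredPotential
  rw [Finset.sum_add_sum_compl]
  exact (sum_eq_sum_cluster σ _).symm

theorem SamplingBound.step_covered [NeZero n] {t u : ℕ} {a b f : ℝ}
    (h : SamplingBound ℓ x σ t u a b f) (ha : 0 ≤ a) (hf : 0 ≤ f)
    {S : Finset (Fin n)} (hS : S.Nonempty) (hu : ((S.image σ)ᶜ).card = u) {i : Fin n}
    (hi : σ i ∈ S.image σ) :
    expectedPotentialFrom ℓ x t (insert i S) ≤
      a * coveredPotential ℓ x σ S + b * uncoveredCost ℓ x σ S +
        f * uncoveredPotential ℓ x σ S := by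
  have him : (insert i S).image σ = S.image σ := by
    rw [Finset.image_insert, Finset.insert_eq_of_mem hi]
  refine (h (insert i S) (Finset.insert_nonempty _ _) (by rw [him, hu])).trans ?_
  have h1 : coveredPotential ℓ x σ (insert i S) ≤ coveredPotential ℓ x σ S := by
    unfold coveredPotential
    rw [him]
    exact Finset.sum_le_sum fun j _ => clusterPotential_anti hS (Finset.subset_insert _ _) j
  have h2 : uncoveredPotential ℓ x σ (insert i S) ≤ uncoveredPotential ℓ x σ S := by
    unfold uncoveredPotential
    rw [him]
    exact Finset.sum_le_sum fun j _ => clusterPotential_anti hS (Finset.subset_insert _ _) j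
  have h3 : uncoveredCost ℓ x σ (insert i S) = uncoveredCost ℓ x σ S := by
    unfold uncoveredCost
    rw [him]
  rw [h3]
  gcongr

/-- The new cost of the cluster that is hit is left as it is: only its average over the sampled
point of that cluster can be bounded by `rD * clusterCost`. -/
theorem SamplingBound.step_uncovered [NeZero n] {t u : ℕ} {a b f : ℝ}
    (h : SamplingBound ℓ x σ t u a b f) (ha : 0 ≤ a) (hf : 0 ≤ f)
    {S : Finset (Fin n)} (hS : S.Nonempty) (hu : ((S.image σ)ᶜ).card = u + 1) {i : Fin n}
    (hi : σ i ∉ S.image σ) :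
    expectedPotentialFrom ℓ x t (insert i S) ≤
      a * (coveredPotential ℓ x σ S + clusterPotential ℓ x σ (insert i S) (σ i)) +
        b * (uncoveredCost ℓ x σ S - rD ℓ X * clusterCost ℓ x (cluster σ (σ i))) +
        f * (uncoveredPotential ℓ x σ S - clusterPotential ℓ x σ S (σ i)) := by
  have hic : σ i ∈ (S.image σ)ᶜ := Finset.mem_compl.2 hi
  have him : ((insert i S).image σ)ᶜ = ((S.image σ)ᶜ).erase (σ i) := by
    rw [Finset.image_insert, Finset.compl_insert]
  refine (h (insert i S) (Finset.insert_nonempty _ _)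
    (by rw [him, Finset.card_erase_of_mem hic, hu, Nat.add_sub_cancel])).trans ?_
  have h1 : coveredPotential ℓ x σ (insert i S) ≤
      coveredPotential ℓ x σ S + clusterPotential ℓ x σ (insert i S) (σ i) := by
    unfold coveredPotential
    rw [Finset.image_insert, Finset.sum_insert hi, add_comm]
    exact add_le_add_left
      (Finset.sum_le_sum fun j _ => clusterPotential_anti hS (Finset.subset_insert _ _) j) _
  have h2 : uncoveredPotential ℓ x σ (insert i S) ≤
      uncoveredPotential ℓ x σ S - clusterPotential ℓ x σ S (σ i) := by
    unfold uncoveredPotential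
    rw [him, ← Finset.sum_erase_eq_sub hic]
    exact Finset.sum_le_sum fun j _ => clusterPotential_anti hS (Finset.subset_insert _ _) j
  have h3 : uncoveredCost ℓ x σ (insert i S) =
      uncoveredCost ℓ x σ S - rD ℓ X * clusterCost ℓ x (cluster σ (σ i)) := by
    unfold uncoveredCost
    rw [him, ← Finset.sum_erase_eq_sub hic]
  rw [h3]
  gcongr

/-- The recursion obtained by splitting according to the cluster of the next center. -/
theorem SamplingBound.step [NeZero n] (hℓ : 1 ≤ ℓ) {t u : ℕ} {a₁ b₁ f₁ a₂ b₂ f₂ : ℝ}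
    (h₁ : SamplingBound ℓ x σ t (u + 1) a₁ b₁ f₁) (h₂ : SamplingBound ℓ x σ t u a₂ b₂ f₂)
    (ha₁ : 0 ≤ a₁) (hf₁ : 0 ≤ f₁) (hb₂ : 0 ≤ b₂) (hf₂ : 0 ≤ f₂) (hba : b₂ ≤ a₂)
    {S : Finset (Fin n)} (hS : S.Nonempty) (hu : ((S.image σ)ᶜ).card = u + 1)
    {P O Q : ℝ} (hP : coveredPotential ℓ x σ S = P) (hO : uncoveredCost ℓ x σ S = O)
    (hQ : uncoveredPotential ℓ x σ S = Q) :
    (P + Q) * expectedPotentialFrom ℓ x (t + 1) S ≤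
      P * (a₁ * P + b₁ * O + f₁ * Q) + Q * (a₂ * (P + O)) + f₂ * (u / (u + 1) * Q ^ 2) := by
  have hP0 : 0 ≤ P := hP ▸ coveredPotential_nonneg S
  have hQ0 : 0 ≤ Q := hQ ▸ uncoveredPotential_nonneg S
  have hO0 : 0 ≤ O := hO ▸ uncoveredCost_nonneg S
  have hPQ : P + Q = potential ℓ x (centers x S) := by rw [← hP, ← hQ, covered_add_uncovered]
  rcases eq_or_ne (P + Q) 0 with h0 | h0
  · have hP' : P = 0 := by linarith
    have hQ' : Q = 0 := by linarith
    simp [hP', hQ']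
  set κ : Fin n → ℝ := fun i => pointCost ℓ (centers x S) (x i) with hκ
  set c : Fin k → ℝ := fun j => clusterPotential ℓ x σ S j with hc
  have hκ0 : ∀ i, 0 ≤ κ i := fun i => pointCost_nonneg _ _
  have hc0 : ∀ j, 0 ≤ c j := fun j => clusterPotential_nonneg _ _
  have hcov : ∑ j ∈ S.image σ, ∑ i ∈ cluster σ j,
      κ i * expectedPotentialFrom ℓ x t (insert i S) ≤ P * (a₁ * P + b₁ * O + f₁ * Q) := by
    rw [← hP, ← hO, ← hQ]
    conv_rhs => rw [coveredPotential, Finset.sum_mul]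
    refine Finset.sum_le_sum fun j hj => ?_
    rw [clusterPotential, Finset.sum_mul]
    refine Finset.sum_le_sum fun i hi => mul_le_mul_of_nonneg_left ?_ (hκ0 i)
    have hij : σ i = j := (Finset.mem_filter.1 hi).2
    exact h₁.step_covered ha₁ hf₁ hS hu (hij ▸ hj)
  have hunc : ∀ j ∈ (S.image σ)ᶜ, ∑ i ∈ cluster σ j,
      κ i * expectedPotentialFrom ℓ x t (insert i S) ≤
        c j * (a₂ * (P + O)) + f₂ * (Q * c j - c j ^ 2) := by
    intro j hj
    set o : ℝ := rD ℓ X * clusterCost ℓ x (cluster σ j) with ho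
    have ho_le : o ≤ O := hO ▸ Finset.single_le_sum
      (f := fun j => rD ℓ X * clusterCost ℓ x (cluster σ j))
      (fun _ _ => mul_nonneg (rD_nonneg _ _) (clusterCost_nonneg _)) hj
    have hstep : ∀ i ∈ cluster σ j, κ i * expectedPotentialFrom ℓ x t (insert i S) ≤
        κ i * (a₂ * P + b₂ * (O - o) + f₂ * (Q - c j)) +
          a₂ * (κ i * ∑ b ∈ cluster σ j, pointCost ℓ (centers x (insert i S)) (x b)) := by
      intro i hi
      have hij : σ i = j := (Finset.mem_filter.1 hi).2
      have := h₂.step_uncovered (hb₂.trans hba) hf₂ hS hu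
        (i := i) (hij ▸ Finset.mem_compl.1 hj)
      rw [hij, hP, hO, hQ] at this
      refine (mul_le_mul_of_nonneg_left this (hκ0 i)).trans (le_of_eq ?_)
      rw [clusterPotential]
      ring
    refine (Finset.sum_le_sum hstep).trans ?_
    rw [Finset.sum_add_distrib, ← Finset.sum_mul, ← Finset.mul_sum]
    have hD := mul_le_mul_of_nonneg_left (sum_pointCost_mul_le (x := x) hℓ hS (cluster σ j))
      (hb₂.trans hba)
    change _ ≤ a₂ * (c j * o) at hD
    change c j * _ + _ ≤ _
    -- Raising `b₂` to `a₂` on the clusters still uncovered makes the bound a₂(P + O), independent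
    -- of the cluster hit.
    have hd : 0 ≤ c j * ((a₂ - b₂) * (O - o)) :=
      mul_nonneg (hc0 j) (mul_nonneg (by linarith) (by linarith))
    linarith
  -- Cauchy–Schwarz over the `u + 1` uncovered clusters; this produces the factor `u / (u + 1)`.
  have hsq : Q ^ 2 ≤ (u + 1) * ∑ j ∈ (S.image σ)ᶜ, c j ^ 2 := by
    have := sq_sum_le_card_mul_sum_sq (s := (S.image σ)ᶜ) (f := c)
    rw [hu] at this
    rw [← hQ]
    exact_mod_cast this
  have hsq' : Q * Q - ∑ j ∈ (S.image σ)ᶜ, c j ^ 2 ≤ u / (u + 1) * Q ^ 2 := by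
    have hu0 : (0 : ℝ) < u + 1 := by positivity
    have h1 : Q ^ 2 / (u + 1) ≤ ∑ j ∈ (S.image σ)ᶜ, c j ^ 2 := by
      rwa [div_le_iff₀' hu0]
    have h2 : (u : ℝ) / (u + 1) * Q ^ 2 = Q * Q - Q ^ 2 / (u + 1) := by
      field_simp
      ring
    linarith
  have hU := Finset.sum_le_sum hunc
  rw [Finset.sum_add_distrib, ← Finset.sum_mul, ← Finset.mul_sum, Finset.sum_sub_distrib,
    ← Finset.mul_sum] at hU
  have hQc : ∑ j ∈ (S.image σ)ᶜ, c j = Q := hQ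
  rw [hQc] at hU
  have hF := mul_le_mul_of_nonneg_left hsq' hf₂
  rw [hPQ, potential_mul_expectedPotentialFrom_succ t hS (hPQ ▸ h0), sum_eq_sum_cluster σ,
    ← Finset.sum_add_sum_compl (S.image σ)]
  linarith

theorem samplingBound_zero [NeZero n] (u : ℕ) {a b f : ℝ} (ha : 1 ≤ a) (hb : 0 ≤ b)
    (hf : 1 ≤ f) : SamplingBound ℓ x σ 0 u a b f := by
  intro S _ _
  rw [expectedPotentialFrom_zero, ← covered_add_uncovered (σ := σ)]
  have h1 := mul_le_mul_of_nonneg_right ha (coveredPotential_nonneg (ℓ := ℓ) (x := x) (σ := σ) S)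
  have h2 := mul_nonneg hb (uncoveredCost_nonneg (ℓ := ℓ) (x := x) (σ := σ) S)
  have h3 := mul_le_mul_of_nonneg_right hf
    (uncoveredPotential_nonneg (ℓ := ℓ) (x := x) (σ := σ) S)
  linarith

theorem samplingBound_of_uncovered_eq_zero [NeZero n] (t : ℕ) {a b f : ℝ} (ha : 1 ≤ a) :
    SamplingBound ℓ x σ t 0 a b f := by
  intro S hS hu
  refine (expectedPotentialFrom_le t hS).trans ?_
  rw [← covered_add_uncovered (σ := σ)]
  have h0 : uncoveredPotential ℓ x σ S = 0 := by
    rw [uncoveredPotential, Finset.card_eq_zero.1 hu, Finset.sum_empty]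
  have h1 : uncoveredCost ℓ x σ S = 0 := by
    rw [uncoveredCost, Finset.card_eq_zero.1 hu, Finset.sum_empty]
  have h2 := mul_le_mul_of_nonneg_right ha (coveredPotential_nonneg (ℓ := ℓ) (x := x) (σ := σ) S)
  rw [h0, h1]
  linarith

end OneStep

/-! ### Solving the recursion: harmonic and golden-ratio coefficients. -/

section Recursion

variable {X : Type*} [MetricSpace X] {n k : ℕ} {ℓ : ℝ} {x : Fin n → X} {σ : Fin n → Fin k}

/-- Cancels the total potential; when it is zero the sampling probabilities are meaningless and the
trivial bound `E ≤ P + Q` takes over. -/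
theorem le_of_add_mul_le_add_mul {P Q E B : ℝ} (hP : 0 ≤ P) (hQ : 0 ≤ Q) (hE : E ≤ P + Q)
    (hB : 0 ≤ B) (h : (P + Q) * E ≤ (P + Q) * B) : E ≤ B := by
  rcases (add_nonneg hP hQ).eq_or_lt with h0 | h0
  · linarith
  · exact le_of_mul_le_mul_left h h0

theorem expectedPotentialFrom_le_covered_add_uncovered [NeZero n] (t : ℕ) {S : Finset (Fin n)}
    (hS : S.Nonempty) :
    expectedPotentialFrom ℓ x t S ≤ coveredPotential ℓ x σ S + uncoveredPotential ℓ x σ S :=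
  (expectedPotentialFrom_le t hS).trans (covered_add_uncovered S).ge

/-- Bounds for at most as many steps as there are uncovered clusters. -/
theorem samplingBound_of_le [NeZero n] (hℓ : 1 ≤ ℓ) {a b : ℕ → ℝ} (ha0 : 1 ≤ a 0) (hb0 : 0 ≤ b 0)
    (hba : ∀ t, b t ≤ a t) (ha : ∀ t : ℕ, a t + 1 / (t + 1) ≤ a (t + 1))
    (hb : ∀ t, a t ≤ b (t + 1)) {t u : ℕ} (htu : t ≤ u) :
    SamplingBound ℓ x σ t u (a t) (b t) (((u : ℝ) - t) / u) := by
  have hamono : Monotone a := monotone_nat_of_le_succ fun t => by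
    have := ha t
    have : (0 : ℝ) ≤ 1 / (t + 1) := by positivity
    linarith
  have ha1 : ∀ t, 1 ≤ a t := fun t => ha0.trans (hamono (Nat.zero_le t))
  have hb1 : ∀ t, 0 ≤ b t := fun t => by
    cases t with
    | zero => exact hb0
    | succ t => exact (zero_le_one.trans (ha1 t)).trans (hb t)
  induction t generalizing u with
  | zero =>
    rcases Nat.eq_zero_or_pos u with rfl | hu
    · exact samplingBound_of_uncovered_eq_zero 0 ha0
    · refine samplingBound_zero u ha0 hb0 (le_of_eq ?_)
      have : (u : ℝ) ≠ 0 := by positivity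
      simp [this]
  | succ t ih =>
    obtain ⟨v, rfl⟩ : ∃ v, u = v + 1 := ⟨u - 1, by omega⟩
    have htv : t ≤ v := by omega
    have htv' : (t : ℝ) ≤ v := by exact_mod_cast htv
    have hv0 : (0 : ℝ) < v + 1 := by positivity
    intro S hS hu
    have hP0 := coveredPotential_nonneg (ℓ := ℓ) (x := x) (σ := σ) S
    have hQ0 := uncoveredPotential_nonneg (ℓ := ℓ) (x := x) (σ := σ) S
    have hO0 := uncoveredCost_nonneg (ℓ := ℓ) (x := x) (σ := σ) S
    have hstep := (ih (htv.trans (Nat.le_succ v))).step hℓ (ih htv)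
      (zero_le_one.trans (ha1 t))
      (div_nonneg (by push_cast; linarith) (Nat.cast_nonneg _)) (hb1 t)
      (div_nonneg (by linarith) (Nat.cast_nonneg _)) (hba t) hS hu rfl rfl rfl
    have hE := expectedPotentialFrom_le_covered_add_uncovered (ℓ := ℓ) (x := x) (σ := σ) (t + 1) hS
    set P := coveredPotential ℓ x σ S
    set Q := uncoveredPotential ℓ x σ S
    set O := uncoveredCost ℓ x σ S
    set f : ℝ := (v - t) / (v + 1) with hf
    have hf0 : 0 ≤ f := div_nonneg (by linarith) hv0.le
    have hf' : ((v + 1 : ℕ) - (t + 1 : ℕ) : ℝ) / (v + 1 : ℕ) = f := by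
      rw [hf]; push_cast; congr 1; ring
    have hf₁ : ((v + 1 : ℕ) - t : ℝ) / (v + 1 : ℕ) = f + 1 / (v + 1) := by
      rw [hf]; push_cast; ring
    -- The coefficient of Q² is reproduced exactly. For `v = 0` the quotient by zero is 0, which
    -- agrees with `f = 0`.
    have hf₂ : ((v : ℝ) - t) / v * (v / (v + 1) * Q ^ 2) = f * Q ^ 2 := by
      rcases Nat.eq_zero_or_pos v with rfl | hv
      · have : t = 0 := by omega
        simp [hf, this]
      · have : (v : ℝ) ≠ 0 := by positivity
        rw [hf]; field_simp
    rw [hf']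
    rw [hf₁, hf₂] at hstep
    have h1 : (1 : ℝ) / (v + 1) ≤ 1 / (t + 1) := by gcongr
    have h2 := ha t
    have h3 : (0 : ℝ) ≤ 1 / (v + 1) := by positivity
    refine le_of_add_mul_le_add_mul hP0 hQ0 hE (add_nonneg (add_nonneg
      (mul_nonneg (zero_le_one.trans (ha1 _)) hP0) (mul_nonneg (hb1 _) hO0))
      (mul_nonneg hf0 hQ0)) (hstep.trans ?_)
    -- Comparison of the coefficients of P², PO, PQ and QO. The third forces the increments 1/(t+1)
    -- of `a`, the fourth forces `a t ≤ b (t + 1)`.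
    have e1 : 0 ≤ (a (t + 1) - a t) * P ^ 2 := mul_nonneg (by linarith) (sq_nonneg _)
    have e2 : 0 ≤ (b (t + 1) - b t) * (P * O) :=
      mul_nonneg (by linarith [hb t, hba t]) (mul_nonneg hP0 hO0)
    have e3 : 0 ≤ (a (t + 1) - a t - 1 / (v + 1)) * (P * Q) :=
      mul_nonneg (by linarith) (mul_nonneg hP0 hQ0)
    have e4 : 0 ≤ (b (t + 1) - a t) * (Q * O) :=
      mul_nonneg (by linarith [hb t]) (mul_nonneg hQ0 hO0)
    linarith

theorem samplingBound_harmonic [NeZero n] (hℓ : 1 ≤ ℓ) (u : ℕ) :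
    SamplingBound ℓ x σ u u (1 + (harmonic u : ℝ)) (1 + (harmonic u : ℝ)) 0 := by
  have h := samplingBound_of_le (x := x) (σ := σ) hℓ (a := fun t => 1 + (harmonic t : ℝ))
    (b := fun t => 1 + (harmonic t : ℝ)) (by simp) (by simp) (fun _ => le_rfl)
    (fun t => by rw [harmonic_succ]; push_cast; rw [one_div, add_assoc])
    (fun t => by
      rw [harmonic_succ]; push_cast
      have : (0 : ℝ) ≤ ((t : ℝ) + 1)⁻¹ := by positivity
      linarith) (le_refl u)
  simpa using h

-- Double induction on the extra steps `s` and the uncovered clusters `u`: a covered hit uses up an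
-- extra step, an uncovered hit lowers `u`. For `s = 0` the coefficients are `u + 1` and `u`, an
-- instance of `samplingBound_of_le`.
open Real in
theorem samplingBound_golden [NeZero n] (hℓ : 1 ≤ ℓ) (s u : ℕ) :
    SamplingBound ℓ x σ (u + s) u (1 + goldenRatio * u / (s + goldenRatio))
      (1 + goldenRatio * ((u : ℝ) - 1) / (s + goldenRatio)) 0 := by
  have hφ := goldenRatio_pos
  have hφ1 := one_lt_goldenRatio
  have hφ2 := goldenRatio_sq
  generalize goldenRatio = g at *
  induction s generalizing u with
  | zero =>
    have h := samplingBound_of_le (x := x) (σ := σ) hℓ (a := fun t => (t : ℝ) + 1)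
      (b := fun t => (t : ℝ)) (by simp) (by simp) (fun _ => by simp)
      (fun t => by
        have : (1 : ℝ) / (t + 1) ≤ 1 := by
          rw [div_le_one (by positivity)]
          linarith [Nat.cast_nonneg (α := ℝ) t]
        push_cast
        linarith) (fun t => by simp) (le_refl u)
    have h1 : (1 + g * u / ((0 : ℕ) + g)) = (u : ℝ) + 1 := by
      rw [Nat.cast_zero]; field_simp; ring
    have h2 : (1 + g * ((u : ℝ) - 1) / ((0 : ℕ) + g)) = (u : ℝ) := by
      rw [Nat.cast_zero]; field_simp; ring
    rw [h1, h2]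
    simpa using h
  | succ s ihs =>
    induction u with
    | zero => exact samplingBound_of_uncovered_eq_zero _ (by simp)
    | succ u ihu =>
      intro S hS hu
      have hP0 := coveredPotential_nonneg (ℓ := ℓ) (x := x) (σ := σ) S
      have hQ0 := uncoveredPotential_nonneg (ℓ := ℓ) (x := x) (σ := σ) S
      have hO0 := uncoveredCost_nonneg (ℓ := ℓ) (x := x) (σ := σ) S
      have hs0 : (0 : ℝ) ≤ s := Nat.cast_nonneg s
      have hu0 : (0 : ℝ) ≤ u := Nat.cast_nonneg u
      have ih₁ := ihs (u + 1)
      rw [show u + 1 + s = u + (s + 1) by ring] at ih₁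
      push_cast at ih₁ ihu ⊢
      rw [add_sub_cancel_right] at ih₁ ⊢
      rw [show u + 1 + (s + 1) = u + (s + 1) + 1 by ring]
      set w : ℝ := ((s : ℝ) + 1 + g)⁻¹ with hw
      set z : ℝ := ((s : ℝ) + g)⁻¹ with hz
      have hw0 : 0 < w := by positivity
      have hz0 : 0 < z := by positivity
      have hzw : z - w = z * w := by
        rw [hz, hw]; field_simp; ring
      -- This is where the golden ratio enters: the claim is s + 1 + g ≤ g(s + g), which for s = 0
      -- is the equality g² = g + 1.
      have hzφ : z ≤ g * w := by
        rw [hz, hw, ← div_eq_mul_inv, le_div_iff₀ (by positivity), inv_mul_le_iff₀ (by positivity)]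
        nlinarith [hφ1]
      have hφw : g * w ≤ 1 := by
        rw [hw, ← div_eq_mul_inv, div_le_one (by positivity)]
        linarith
      simp only [div_eq_mul_inv, ← hw, ← hz] at ih₁ ihu ⊢
      have hb2 : 0 ≤ 1 + g * ((u : ℝ) - 1) * w := by
        have : 0 ≤ g * u * w := by positivity
        linarith
      have hstep := ih₁.step hℓ ihu (by positivity) le_rfl hb2 le_rfl
        (by linarith [mul_pos hφ hw0]) hS hu rfl rfl rfl
      have hE := expectedPotentialFrom_le_covered_add_uncovered (ℓ := ℓ) (x := x) (σ := σ)
        (u + (s + 1) + 1) hS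
      set P := coveredPotential ℓ x σ S
      set Q := uncoveredPotential ℓ x σ S
      set O := uncoveredCost ℓ x σ S
      -- For small Q the trivial bound P + Q already suffices. For large Q the gain gwPQ pays for
      -- the loss z - w = zw ≤ gw² in the coefficients of P² and PO.
      rcases le_or_gt Q (g * (u + 1) * w * P + (1 + g * u * w) * O) with hQ | hQ
      · linarith
      refine le_of_add_mul_le_add_mul hP0 hQ0 hE (by positivity) (hstep.trans ?_)
      have e1 := mul_le_mul_of_nonneg_left hQ.le (show 0 ≤ g * w * P by positivity)
      have e2 : g * (u + 1) * (z - w) * P ^ 2 ≤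
          g * (u + 1) * (g * w * w) * P ^ 2 := by
        rw [hzw]; gcongr
      have e3 : g * u * (z - w) * (P * O) ≤
          g * u * (g * w * w) * (P * O) := by
        rw [hzw]; gcongr
      have e4 : 0 ≤ g * w * P * O := by positivity
      linarith

end Recursion

/-! ### The first center and the passage to the optimal potential. -/

section Main

variable {X : Type*} [MetricSpace X] {n k : ℕ} {ℓ : ℝ}

theorem expectedPotential_le_of_clustering [NeZero n] (x : Fin n → X) (σ : Fin n → Fin k)
    {t : ℕ} {a b s : ℝ}
    (h : SamplingBound ℓ x σ t (k - 1) a b 0) (ha : 0 ≤ a) (hℓ : 1 ≤ ℓ)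
    (hab : a * rU ℓ X ≤ b * rD ℓ X)
    (hs : ∀ A : Finset (Fin n), ∑ a ∈ A, ∑ b ∈ A, dist (x a) (x b) ^ ℓ ≤
          rU ℓ X * ((A.card : ℝ) - s) * clusterCost ℓ x A) :
    expectedPotential ℓ x (t + 1) ≤
      (b * rD ℓ X - (2 * (b * rD ℓ X - a * rU ℓ X) + a * rU ℓ X * s) / n) *
        ∑ j, clusterCost ℓ x (cluster σ j) := by
  have hn : (0 : ℝ) < n := by exact_mod_cast Nat.pos_of_ne_zero (NeZero.ne n)
  set W := ∑ j, clusterCost ℓ x (cluster σ j) with hW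
  set o : Fin k → ℝ := fun j => clusterCost ℓ x (cluster σ j) with ho
  have hstart : ∀ i, expectedPotentialFrom ℓ x t {i} ≤
      a * ∑ b ∈ cluster σ (σ i), dist (x i) (x b) ^ ℓ + b * (rD ℓ X * (W - o (σ i))) := by
    intro i
    refine (h {i} (Finset.singleton_nonempty i) ?_).trans ?_
    · rw [Finset.image_singleton, Finset.card_compl, Finset.card_singleton, Fintype.card_fin]
    have h1 : coveredPotential ℓ x σ {i} ≤ ∑ b ∈ cluster σ (σ i), dist (x i) (x b) ^ ℓ := by
      rw [coveredPotential, Finset.image_singleton, Finset.sum_singleton]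
      refine Finset.sum_le_sum fun b _ => ?_
      rw [dist_comm]
      exact pointCost_centers_le (Finset.mem_singleton_self i) _
    have h2 : uncoveredCost ℓ x σ {i} = rD ℓ X * (W - o (σ i)) := by
      rw [uncoveredCost, Finset.image_singleton, ← Finset.mul_sum, hW,
        ← Finset.sum_add_sum_compl {σ i}, Finset.sum_singleton, add_sub_cancel_left]
    rw [h2, zero_mul, add_zero]
    gcongr
  have hclu : ∀ j, ∑ i ∈ cluster σ j, expectedPotentialFrom ℓ x t {i} ≤
      a * (rU ℓ X * (((cluster σ j).card : ℝ) - s) * o j) +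
        (cluster σ j).card * (b * (rD ℓ X * (W - o j))) := by
    intro j
    calc _ ≤ ∑ i ∈ cluster σ j, (a * ∑ b ∈ cluster σ j, dist (x i) (x b) ^ ℓ +
            b * (rD ℓ X * (W - o j))) := by
          refine Finset.sum_le_sum fun i hi => ?_
          have hij : σ i = j := (Finset.mem_filter.1 hi).2
          simpa only [hij] using hstart i
      _ ≤ _ := by
          rw [Finset.sum_add_distrib, ← Finset.mul_sum, Finset.sum_const, nsmul_eq_mul]
          gcongr
          exact hs _
  -- A uniform first center lands in a cluster with probability proportional to its size, so the
  -- saving is weighted by cluster sizes; clusters of size at most 1 cost nothing.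
  have htwo : 2 * W ≤ ∑ j, ((cluster σ j).card : ℝ) * o j := by
    rw [hW, Finset.mul_sum]
    refine Finset.sum_le_sum fun j _ => ?_
    rcases le_or_gt (cluster σ j).card 1 with h1 | h1
    · have : o j = 0 := clusterCost_eq_zero hℓ h1
      rw [this]
      change 2 * o j ≤ _
      rw [this, mul_zero, mul_zero]
    · have : (2 : ℝ) ≤ (cluster σ j).card := by exact_mod_cast h1
      exact mul_le_mul_of_nonneg_right this (clusterCost_nonneg _)
  have hcard : ∑ j, ((cluster σ j).card : ℝ) = n := by
    have := (sum_eq_sum_cluster σ fun _ => (1 : ℝ)).symm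
    simpa using this
  rw [expectedPotential_succ, div_le_iff₀ hn]
  have hsum : ∑ i, expectedPotentialFrom ℓ x t {i} ≤
      b * rD ℓ X * W * n - (b * rD ℓ X - a * rU ℓ X) * ∑ j, ((cluster σ j).card : ℝ) * o j
        - a * rU ℓ X * s * W := by
    rw [sum_eq_sum_cluster σ]
    refine (Finset.sum_le_sum fun j _ => hclu j).trans (le_of_eq ?_)
    have h1 : b * rD ℓ X * W * n = ∑ j, b * rD ℓ X * W * ((cluster σ j).card : ℝ) := by
      rw [← hcard, Finset.mul_sum]
    have h2 : a * rU ℓ X * s * W = ∑ j, a * rU ℓ X * s * o j := Finset.mul_sum _ _ _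
    rw [h1, h2, Finset.mul_sum (f := fun j => ((cluster σ j).card : ℝ) * o j),
      ← Finset.sum_sub_distrib, ← Finset.sum_sub_distrib]
    refine Finset.sum_congr rfl fun j _ => ?_
    ring
  have hC := mul_le_mul_of_nonneg_left htwo (sub_nonneg.2 hab)
  have hfin : (b * rD ℓ X - (2 * (b * rD ℓ X - a * rU ℓ X) + a * rU ℓ X * s) / n) * W * n =
      b * rD ℓ X * W * n - (2 * (b * rD ℓ X - a * rU ℓ X) + a * rU ℓ X * s) * W := by
    field_simp
  rw [hfin]
  linarith

/-- Each point joins a nearest center. This replaces an optimal clustering, which need not come from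
any minimizer. -/
theorem exists_sum_clusterCost_le [NeZero k] (ℓ : ℝ) (x : Fin n → X) (c : Fin k → X) :
    ∃ σ : Fin n → Fin k, ∑ j, clusterCost ℓ x (cluster σ j) ≤ potential ℓ x c := by
  choose σ hσ using fun i => exists_pointCost_eq (ℓ := ℓ) c (x i)
  refine ⟨σ, ?_⟩
  rw [potential, sum_eq_sum_cluster σ]
  refine Finset.sum_le_sum fun j _ => (clusterCost_le _ (c j)).trans (le_of_eq ?_)
  refine Finset.sum_congr rfl fun i hi => ?_
  have hij : σ i = j := (Finset.mem_filter.1 hi).2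
  rw [← hσ, hij]

theorem sum_clusterCost_nonneg (x : Fin n → X) (σ : Fin n → Fin k) :
    0 ≤ ∑ j, clusterCost ℓ x (cluster σ j) :=
  Finset.sum_nonneg fun _ _ => clusterCost_nonneg _

theorem optimalPotential_eq_zero [NeZero k] (hℓ : 1 ≤ ℓ) (x : Fin 1 → X) :
    optimalPotential ℓ x k = 0 := by
  refine le_antisymm ?_ (Real.iInf_nonneg fun _ => potential_nonneg _ _ _)
  refine (ciInf_le ⟨0, ?_⟩ fun _ => x 0).trans ?_
  · rintro _ ⟨c, rfl⟩
    exact potential_nonneg _ _ _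
  · simp [potential, pointCost, Real.zero_rpow (by linarith : ℓ ≠ 0)]

/-- Moving `K` inside the infimum needs `0 ≤ K`. For `n = 1` the correction may make `K` negative,
but then all cluster costs and the optimum are zero. -/
theorem le_mul_optimalPotential [NeZero n] [NeZero k] (hℓ : 1 ≤ ℓ) (x : Fin n → X) {E K : ℝ}
    (h : ∀ σ : Fin n → Fin k, E ≤ K * ∑ j, clusterCost ℓ x (cluster σ j))
    (hK : 2 ≤ n → 0 ≤ K) : E ≤ K * optimalPotential ℓ x k := by
  rcases Nat.lt_or_ge n 2 with hn | hn
  · obtain rfl : n = 1 := by have := NeZero.ne n; omega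
    rw [optimalPotential_eq_zero hℓ, mul_zero]
    refine (h fun _ => 0).trans (le_of_eq ?_)
    rw [Finset.sum_eq_zero, mul_zero]
    exact fun j _ => clusterCost_eq_zero hℓ ((Finset.card_le_univ _).trans (by simp))
  · have : Nonempty X := ⟨x 0⟩
    rw [optimalPotential, Real.mul_iInf_of_nonneg (hK hn)]
    refine le_ciInf fun c => ?_
    obtain ⟨σ, hσ⟩ := exists_sum_clusterCost_le ℓ x c
    exact (h σ).trans (mul_le_mul_of_nonneg_left hσ (hK hn))

/-- The bound on the expected potential that follows from a `SamplingBound` for the state after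
the first center. -/
theorem expectedPotential_le [NeZero n] [NeZero k] (x : Fin n → X) {t : ℕ} {a b s δ : ℝ}
    (h : ∀ σ : Fin n → Fin k, SamplingBound ℓ x σ t (k - 1) a b 0) (ha : 0 ≤ a) (hℓ : 1 ≤ ℓ)
    (hab : a * rU ℓ X ≤ b * rD ℓ X)
    (hs : ∀ A : Finset (Fin n), ∑ a ∈ A, ∑ b ∈ A, dist (x a) (x b) ^ ℓ ≤
          rU ℓ X * ((A.card : ℝ) - s) * clusterCost ℓ x A)
    (hδ : δ ≤ 2 * (b * rD ℓ X - a * rU ℓ X) + a * rU ℓ X * s) (hδ' : δ ≤ 2 * (b * rD ℓ X)) :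
    expectedPotential ℓ x (t + 1) ≤ (b * rD ℓ X - δ / n) * optimalPotential ℓ x k := by
  refine le_mul_optimalPotential hℓ x (fun σ => ?_) fun hn => ?_
  · refine (expectedPotential_le_of_clustering x σ (h σ) ha hℓ hab hs).trans ?_
    gcongr
    exact sum_clusterCost_nonneg x σ
  · have hn' : (2 : ℝ) ≤ n := by exact_mod_cast hn
    have hb : 0 ≤ b * rD ℓ X := (mul_nonneg ha (rU_nonneg ℓ X)).trans hab
    rw [sub_nonneg, div_le_iff₀ (by linarith)]
    nlinarith

theorem expectedPotential_succ_anti [NeZero n] (x : Fin n → X) :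
    Antitone fun t => expectedPotential ℓ x (t + 1) := by
  intro t t' h
  simp only [expectedPotential_succ]
  gcongr with i
  exact expectedPotentialFrom_anti (Finset.singleton_nonempty i) h

end Main

theorem theorem1 (ℓ : ℝ) (hℓ : 1 ≤ ℓ) (k : ℕ) (hk : 2 ≤ k) (β : ℝ) (hβ : 1 ≤ β)
    (t : ℕ) (ht : (t : ℝ) = β * (k : ℝ)) :
    ∃ c : ℝ, 0 < c ∧
      ∀ (X : Type*) [MetricSpace X] (n : ℕ) [NeZero n] (x : Fin n → X),
        expectedPotential ℓ x t
            ≤ (rD ℓ X * (1 + min (goldenTerm k β) ((harmonic (k - 1) : ℚ) : ℝ)) - c / (n : ℝ))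
                * optimalPotential ℓ x k ∧
        0 ≤ correctionC ℓ X k β ∧
        expectedPotential ℓ x t
            ≤ (rD ℓ X * (1 + goldenTerm k β) - 2 * correctionC ℓ X k β / (n : ℝ))
                * optimalPotential ℓ x k := by
  -- The constant 1 works throughout: every correction numerator found below is at least 1.
  refine ⟨1, one_pos, fun X _ n _ x => ?_⟩
  have : NeZero k := ⟨by omega⟩
  have hk' : (2 : ℝ) ≤ k := by exact_mod_cast hk
  have hkt : k ≤ t := by
    have : (k : ℝ) ≤ t := by rw [ht]; nlinarith
    exact_mod_cast this
  obtain ⟨m, rfl⟩ := Nat.exists_eq_add_of_le hkt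
  obtain ⟨u, rfl⟩ : ∃ u, k = u + 1 := ⟨k - 1, by omega⟩
  have hm : (β - 1) * ((u + 1 : ℕ) : ℝ) = m := by
    push_cast at ht ⊢
    linarith
  have hu : (1 : ℝ) ≤ u := by push_cast at hk'; linarith
  have hφ := Real.goldenRatio_pos
  set R := rU ℓ X with hR
  have hR2 : 2 ≤ R := two_le_rU hℓ X
  have hL : (2 : ℝ) ≤ 2 ^ ℓ := two_le_two_rpow hℓ
  have hD : rD ℓ X = 2 ^ ℓ * R := rfl
  obtain ⟨s, hs0, hs, hunif⟩ := exists_sum_dist_rpow_le_rU (X := X) hℓ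
  set w : ℝ := Real.goldenRatio / (m + Real.goldenRatio) with hw
  have hw0 : 0 ≤ w := by positivity
  have hw1 : w ≤ 1 := by
    rw [hw, div_le_one (by positivity)]
    linarith [Nat.cast_nonneg (α := ℝ) m]
  have hg : goldenTerm (u + 1) β = w * (u - 1) := by
    rw [goldenTerm, hm, hw]; push_cast; ring
  have hC : correctionC ℓ X (u + 1) β = (1 + w * (u - 1)) * rD ℓ X - (1 + w * u) * R := by
    rw [correctionC, hg, hm, hw]; push_cast; ring
  have hgold : ∀ σ : Fin n → Fin (u + 1),
      SamplingBound ℓ x σ (u + m) (u + 1 - 1) (1 + w * u) (1 + w * (u - 1)) 0 := fun σ => by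
    have h := samplingBound_golden (x := x) (σ := σ) hℓ m u
    rwa [mul_div_right_comm, mul_div_right_comm] at h
  have hwu : 0 ≤ w * (u - 1) := mul_nonneg hw0 (by linarith)
  -- The difference of the sides is (1 - w) + w(u - 1). With `2 ≤ 2 ^ ℓ` this gives C ≥ 0.
  have hab2 : 1 + w * u ≤ 2 * (1 + w * (u - 1)) := by linarith
  have hab : (1 + w * u) * R ≤ (1 + w * (u - 1)) * rD ℓ X := by
    rw [hD, ← mul_assoc]
    refine mul_le_mul_of_nonneg_right ?_ (by linarith)
    nlinarith
  have haR : 2 ≤ (1 + w * u) * R := by nlinarith [mul_nonneg hw0 (by linarith : (0 : ℝ) ≤ u)]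
  have ha0 : 0 ≤ 1 + w * u := by positivity
  have hC0 : 0 ≤ correctionC ℓ X (u + 1) β := by rw [hC]; linarith
  rw [show u + 1 + m = u + m + 1 by ring, hg]
  refine ⟨?_, hC0, ?_⟩
  · rcases min_choice (w * ((u : ℝ) - 1)) ((harmonic (u + 1 - 1) : ℚ) : ℝ) with h | h <;> rw [h]
    · rw [mul_comm (rD ℓ X)]
      refine expectedPotential_le x hgold ha0 hℓ hab (hunif n x) ?_ (by linarith)
      -- C alone may vanish (ℓ = 1, k = 2, β = 1), so for `s = 1` the zero distance of the first
      -- center to itself supplies the gain. In the Euclidean case `rD = 8` and `rU = 2` make C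
      -- itself large enough.
      rcases hs with rfl | ⟨h2, hR'⟩
      · linarith
      · have hL4 : (2 : ℝ) ^ ℓ = 4 := by rw [h2]; norm_num
        have : 0 ≤ (1 + w * u) * R * s := by positivity
        rw [← hR] at hR' ⊢
        rw [hD, hL4, hR']
        rw [hR'] at this
        linarith
    · rw [mul_comm (rD ℓ X), Nat.add_sub_cancel]
      have hH : (0 : ℝ) ≤ (harmonic u : ℝ) := by
        rw [harmonic]; push_cast; positivity
      -- The harmonic bound ignores the `m` extra centers, which can only lower the expectation.
      refine (expectedPotential_succ_anti x (Nat.le_add_right u m)).trans ?_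
      have hDR : 2 * R ≤ rD ℓ X := by
        rw [hD]; exact mul_le_mul_of_nonneg_right hL (by linarith)
      have hgap : 2 * R * (1 + (harmonic u : ℝ)) ≤ (1 + (harmonic u : ℝ)) * rD ℓ X := by
        rw [mul_comm]; exact mul_le_mul_of_nonneg_left hDR (by linarith)
      have hHR : 2 ≤ (1 + (harmonic u : ℝ)) * R := by nlinarith
      refine expectedPotential_le x (fun σ => samplingBound_harmonic hℓ u) (by linarith) hℓ
        (by linarith) (hunif n x) ?_ (by linarith)
      have : 0 ≤ (1 + (harmonic u : ℝ)) * R * s := by positivity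
      linarith
  · rw [mul_comm (rD ℓ X), hC]
    refine expectedPotential_le x hgold ha0 hℓ hab (hunif n x) ?_ (by linarith)
    have : 0 ≤ (1 + w * u) * R * s := by positivity
    linarith
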